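/- Let $k,n$ be integers with $2\le k\le n-2$, and let $\mathcal I$ be the set of all $I\subset\{1,\dots,n\}$ with $\#I=k$. For $I\in\mathcal I$ let $\mathbb Z^k_I\subset\mathbb Z^n$ be the set of integer linear combinations of the canonical vectors $e_i$, $i\in I$, and let $\pi_I:\mathbb Z^n\to\mathbb Z^k_I$ be the orthogonal projection. Given $\mathbf p=(p_I)_{I\in\mathcal I}\in[0,1]^{\mathcal I}$, let $\omega_I=(\omega_I(u))_{u\in\mathbb Z^k_I}$, $I\in\mathcal I$, be independent families of independent $\{0,1\}$-valued random variables with $\mathbb P(\omega_I(u)=1)=p_I$, and let $\mathbb P_{\mathbf p}$ be the law on $\{0,1\}^{\mathbb Z^n}$ of $$\omega(v)=\prod_{I\in\mathcal I}\omega_I(\pi_I(v)),\qquad v\in\mathbb Z^n,$$ with expectation $\mathbb E_{\mathbf p}$. Write $o$ for the origin and $o\leftrightarrow\infty$ for the event that infinitely many sites of $\mathbb Z^n$ can be reached from $o$ by nearest-neighbour paths all of whose sites $v$ (endpoints included) satisfy $\omega(v)=1$. Then $\mathbb E_{\mathbf p}(\omega(o))=\prod_{I\in\mathcal I}p_I$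 for every $\mathbf p\in[0,1]^{\mathcal I}$, and there is $\delta=\delta(n,k)>0$ such that for every $\mathbf p\in[0,1]^{\mathcal I}$, $$\mathbb E_{\mathbf p}(\omega(o))>1-\delta\quad\Longrightarrow\quad \mathbb P_{\mathbf p}(o\leftrightarrow\infty)>0 .$$ -/

import Mathlib

namespace HyperplanePercolation

open MeasureTheory ProbabilityTheory

/-- The sites of the lattice `ℤⁿ`. -/
abbrev Site (n : ℕ) : Type := Fin n → ℤ

/-- The nearest-neighbour graph on `ℤⁿ`: two sites are adjacent iff their `ℓ¹`-distance
(equivalently, their Euclidean distance) is one. -/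
def lattice (n : ℕ) : SimpleGraph (Site n) where
  Adj x y := ∑ i, |x i - y i| = 1
  symm := ⟨fun x y h => by simpa only [abs_sub_comm] using h⟩
  loopless := ⟨fun x h => by simp at h⟩

/-- The family `𝓘(k; n)` of all subsets of `{1, …, n}` that have exactly `k` elements. -/
abbrev Index (n k : ℕ) : Type := {I : Finset (Fin n) // I.card = k}

/-- The coordinate hyperplane `ℤᵏ_I`: the integer combinations of the `e_i`, `i ∈ I`. -/
abbrev CoordPlane {n k : ℕ} (I : Index n k) : Type := {x : Site n // ∀ i, i ∉ I.1 → x i = 0}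

/-- The orthogonal projection `π_I : ℤⁿ → ℤᵏ_I`. -/
def proj {n k : ℕ} (I : Index n k) (v : Site n) : CoordPlane I :=
  ⟨fun i => if i ∈ I.1 then v i else 0, fun i hi => by simp [hi]⟩

/-- Configurations in `{0,1}^{ℤⁿ}`; `true` stands for `1` (open), `false` for `0` (removed). -/
abbrev Config (n : ℕ) : Type := Site n → Bool

/-- Families `(ω_I)_I` of configurations `ω_I ∈ {0,1}^{ℤᵏ_I}`. -/
abbrev PlaneConfig (n k : ℕ) : Type := (I : Index n k) → CoordPlane I → Bool

/-- The configuration `ω(v) = ∏_I ω_I(π_I(v))`: a product of elements of `{0,1}` is `1` iff every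
factor is (see `toNat_hyperplaneConfig` for the numerical product). -/
def hyperplaneConfig {n k : ℕ} (ξ : PlaneConfig n k) : Config n :=
  fun v => decide (∀ I : Index n k, ξ I (proj I v) = true)

theorem toNat_hyperplaneConfig {n k : ℕ} (ξ : PlaneConfig n k) (v : Site n) :
    (hyperplaneConfig ξ v).toNat = ∏ I : Index n k, (ξ I (proj I v)).toNat := by
  by_cases h : ∀ I : Index n k, ξ I (proj I v) = true
  · have h1 : hyperplaneConfig ξ v = true := by
      unfold hyperplaneConfig
      exact decide_eq_true h
    rw [h1, Finset.prod_eq_one (fun I _ => by rw [h I]; rfl)]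
    rfl
  · have h1 : hyperplaneConfig ξ v = false := by
      unfold hyperplaneConfig
      exact decide_eq_false h
    push Not at h
    obtain ⟨I, hI⟩ := h
    rw [h1, Finset.prod_eq_zero (Finset.mem_univ I)]
    · rfl
    · simpa using hI

theorem measurable_hyperplaneConfig {n k : ℕ} :
    Measurable (hyperplaneConfig : PlaneConfig n k → Config n) := by
  refine measurable_pi_lambda _ fun v => measurable_to_bool ?_
  have h : (fun ξ : PlaneConfig n k => hyperplaneConfig ξ v) ⁻¹' {true} =
      ⋂ I : Index n k, (fun ξ : PlaneConfig n k => ξ I (proj I v)) ⁻¹' {true} := by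
    ext ξ
    simp [hyperplaneConfig]
  rw [h]
  refine MeasurableSet.iInter fun I => ?_
  exact ((measurable_pi_apply (proj I v)).comp (measurable_pi_apply I)) (measurableSet_singleton _)

/-- Bernoulli site percolation on the vertex set `V` with parameter `q`: the law under which the
states of the sites are independent and each is `1` with probability `q`. -/
noncomputable def bernoulliSite (V : Type) (q : unitInterval) : Measure (V → Bool) :=
  Measure.infinitePi fun _ : V => bernoulliMeasure true false q

instance (V : Type) (q : unitInterval) : IsProbabilityMeasure (bernoulliSite V q) := by
  unfold bernoulliSite
  infer_instance

/-- The law `ℙ_𝐩` on `{0,1}^{ℤⁿ}` of Bernoulli `(n,k)`-hyperplane percolation: the image, under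
`(ω_I)_I ↦ ω`, of the product of the Bernoulli site percolations with parameters `p_I`. -/
noncomputable def hyperplaneLaw {n k : ℕ} (p : Index n k → unitInterval) : Measure (Config n) :=
  (Measure.pi fun I : Index n k => bernoulliSite (CoordPlane I) (p I)).map hyperplaneConfig

instance {n k : ℕ} (p : Index n k → unitInterval) : IsProbabilityMeasure (hyperplaneLaw p) :=
  Measure.isProbabilityMeasure_map measurable_hyperplaneConfig.aemeasurable

/-- `x ↔ y` in `ω`: some nearest-neighbour path from `x` to `y` has only open sites. -/
def Connects {n : ℕ} (ω : Config n) (x y : Site n) : Prop :=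
  ∃ w : (lattice n).Walk x y, w.IsPath ∧ ∀ z ∈ w.support, ω z = true

/-- The open cluster of `x` in `ω`. -/
def cluster {n : ℕ} (ω : Config n) (x : Site n) : Set (Site n) := {y | Connects ω x y}

/-- The event `o ↔ ∞`: the open cluster of the origin is infinite. -/
def originPercolates (n : ℕ) : Set (Config n) := {ω | (cluster ω 0).Infinite}

end HyperplanePercolation

/-!
Embed `ℤ²` in `ℤⁿ` by `(x, y) ↦ (x + i y)_i` and call a point of `ℤ²` bad if the box of radius `n`
around its image contains a closed site. Any two coordinates of the image determine the point, so,
as `k ≥ 2`, a site of a coordinate hyperplane affects a bounded number of points of `ℤ²` only.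
Consequently the probability that all points of a finite set `S` are bad is at most `η ^ #S`, where
`η` is small when all `p_I` are close to one.

Such a bound yields Lipschitz percolation by a Peierls argument: either some path descends from the
origin below height zero with its sites at the upward steps all bad, which is unlikely, or the
lowest heights from which no such path exists form a Lipschitz function through the origin whose
graph avoids the bad points. The boxes around the graph then overlap enough to contain an infinite
open path starting at the origin of `ℤⁿ`.
-/

namespace HyperplanePercolation

open MeasureTheory ProbabilityTheory

section Lipschitz

variable {V ι : Type*} {step : ι → V → V} {bad : Set (V × ℤ)} {o v : V} {b : ℤ} {z x : V × ℤ}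
  {w : List (Option ι)}

/-- Admissibility, in the sense of Lipschitz percolation, of a path in `V × ℤ` that is followed
backwards from its end point `z` until it is below height zero. A letter `some i` undoes a downward
step and moves the column by `step i`; a letter `none` undoes an upward step, which is only allowed
into a bad site. -/
def Admissible (step : ι → V → V) (bad : Set (V × ℤ)) : V × ℤ → List (Option ι) → Prop
  | z, [] => z.2 < 0
  | z, none :: w => z ∈ bad ∧ Admissible step bad (z.1, z.2 - 1) w
  | z, some i :: w => Admissible step bad (step i z.1, z.2 + 1) w

/-- The sites that the path with end point `z` and backward letters `w` enters by an upward step,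
listed from `z` backwards. -/
def upSites (step : ι → V → V) : V × ℤ → List (Option ι) → List (V × ℤ)
  | _, [] => []
  | z, none :: w => z :: upSites step (z.1, z.2 - 1) w
  | z, some i :: w => upSites step (step i z.1, z.2 + 1) w

/-- `z` is the end point of an admissible path. -/
def Reached (step : ι → V → V) (bad : Set (V × ℤ)) (z : V × ℤ) : Prop :=
  ∃ w, Admissible step bad z w

theorem Admissible.mem_bad_of_mem_upSites (h : Admissible step bad z w)
    (hx : x ∈ upSites step z w) : x ∈ bad := by
  fun_induction upSites step z w with
  | case1 => simp at hx
  | case2 z w ih =>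
    rcases List.mem_cons.1 hx with rfl | hx
    exacts [h.1, ih h.2 hx]
  | case3 z i w ih => exact ih h hx

theorem Admissible.add_length_lt (h : Admissible step bad z w) :
    z.2 + w.length < 2 * (upSites step z w).length := by
  fun_induction upSites step z w with
  | case1 => simpa [Admissible] using h
  | case2 z w ih =>
    have := ih h.2
    simp only [List.length_cons]
    omega
  | case3 z i w ih =>
    have := ih h
    simp only [List.length_cons]
    omega

theorem Admissible.exists_upSites_suffix (h : Admissible step bad z w)
    (hx : x ∈ upSites step z w) :
    ∃ w', Admissible step bad x w' ∧ upSites step x w' <:+ upSites step z w := by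
  fun_induction upSites step z w with
  | case1 => simp at hx
  | case2 z w ih =>
    rcases List.mem_cons.1 hx with rfl | hx
    · exact ⟨none :: w, h, List.suffix_rfl⟩
    · obtain ⟨w', hw', hsuffix⟩ := ih h.2 hx
      exact ⟨w', hw', hsuffix.trans (List.suffix_cons _ _)⟩
  | case3 z i w ih => exact ih h hx

theorem Admissible.exists_nodup_upSites (h : Admissible step bad z w) :
    ∃ w', Admissible step bad z w' ∧ (upSites step z w').Nodup := by
  fun_induction Admissible step bad z w with
  | case1 z => exact ⟨[], h, List.nodup_nil⟩
  | case2 z w ih =>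
    obtain ⟨w', hw', hnodup⟩ := ih h.2
    by_cases hz : z ∈ upSites step (z.1, z.2 - 1) w'
    · obtain ⟨w'', hw'', hsuffix⟩ := hw'.exists_upSites_suffix hz
      exact ⟨w'', hw'', hnodup.sublist hsuffix.sublist⟩
    · exact ⟨none :: w', ⟨h.1, hw'⟩, List.nodup_cons.2 ⟨hz, hnodup⟩⟩
  | case3 z i w ih =>
    obtain ⟨w', hw', hnodup⟩ := ih h
    exact ⟨some i :: w', hw', hnodup⟩

theorem reached_of_neg (hb : b < 0) : Reached step bad (v, b) :=
  ⟨[], hb⟩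

theorem Reached.up (h : Reached step bad (v, b - 1)) (hbad : (v, b) ∈ bad) :
    Reached step bad (v, b) :=
  let ⟨w, hw⟩ := h
  ⟨none :: w, hbad, hw⟩

theorem Reached.down {i : ι} (h : Reached step bad (step i v, b + 1)) : Reached step bad (v, b) :=
  let ⟨w, hw⟩ := h
  ⟨some i :: w, hw⟩

theorem exists_height_of_not_reached
    (hstep : ∀ v, Relation.ReflTransGen (fun u v => ∃ i, step i u = v) o v)
    (h : ¬ Reached step bad (o, 0)) :
    ∃ F : V → ℤ, F o = 0 ∧ (∀ i v, F (step i v) ≤ F v + 1) ∧ ∀ v, (v, F v) ∉ bad := by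
  have hnonneg : ∀ v b, ¬ Reached step bad (v, b) → 0 ≤ b := fun v b hb =>
    not_lt.1 fun hneg => hb (reached_of_neg hneg)
  have hexists : ∀ v, ∃ b, ¬ Reached step bad (v, b) := by
    intro v
    induction hstep v with
    | refl => exact ⟨0, h⟩
    | tail _ huv ih =>
      obtain ⟨b, hb⟩ := ih
      obtain ⟨i, rfl⟩ := huv
      exact ⟨b + 1, fun hb' => hb hb'.down⟩
  choose F hF hFmin using fun v => Int.exists_least_of_bdd ⟨0, hnonneg v⟩ (hexists v)
  have hbelow : ∀ v b, b < F v → Reached step bad (v, b) := fun v b hb =>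
    not_not.1 fun hb' => (hFmin v b hb').not_gt hb
  refine ⟨F, le_antisymm (hFmin o 0 h) (hnonneg o _ (hF o)), fun i v => ?_, fun v hbad => ?_⟩
  · exact not_lt.1 fun hlt => hF v (hbelow _ _ hlt).down
  · exact hF v ((hbelow v _ (by omega)).up hbad)

variable {Ω : Type*} [MeasurableSpace Ω] {μ : Measure Ω} {badSet : Ω → Set (V × ℤ)}
  {r : ENNReal}

theorem measure_admissible_nodup_le (hr : r ≤ 1)
    (hbad : ∀ S : Finset (V × ℤ), μ {ω | ↑S ⊆ badSet ω} ≤ r ^ (2 * S.card)) (hz : 0 ≤ z.2)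
    (w : List (Option ι)) :
    μ {ω | Admissible step (badSet ω) z w ∧ (upSites step z w).Nodup} ≤ r ^ w.length := by
  classical
  rcases Set.eq_empty_or_nonempty
    {ω | Admissible step (badSet ω) z w ∧ (upSites step z w).Nodup} with
    hempty | ⟨ω, hω, hnodup⟩
  · simp [hempty]
  · calc μ {ω | Admissible step (badSet ω) z w ∧ (upSites step z w).Nodup}
        ≤ μ {ω | ↑(upSites step z w).toFinset ⊆ badSet ω} :=
          measure_mono fun ω hω x hx =>
            hω.1.mem_bad_of_mem_upSites (List.mem_toFinset.1 hx)
      _ ≤ r ^ (2 * (upSites step z w).length) := by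
          rw [← List.toFinset_card_of_nodup hnodup]
          exact hbad _
      _ ≤ r ^ w.length := by
          have := hω.add_length_lt
          exact pow_le_pow_right_of_le_one' hr (by omega)

theorem tsum_pow_add_one_lt_one (hr : r < 2⁻¹) : ∑' m : ℕ, r ^ (m + 1) < 1 := by
  have hadd : r + r < 1 := ENNReal.inv_two_add_inv_two ▸ ENNReal.add_lt_add hr hr
  rw [ENNReal.tsum_geometric_add_one, ← div_eq_mul_inv]
  have hlt : r < 1 - r := lt_tsub_iff_right.2 hadd
  exact ENNReal.div_lt_of_lt_mul (by simpa using hlt)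

variable [Fintype ι]

theorem measure_reached_lt_one (hr : (Fintype.card ι + 1) * r < 2⁻¹)
    (hbad : ∀ S : Finset (V × ℤ), μ {ω | ↑S ⊆ badSet ω} ≤ r ^ (2 * S.card)) :
    μ {ω | Reached step (badSet ω) (o, 0)} < 1 := by
  have hr1 : r ≤ 1 :=
    calc r ≤ (Fintype.card ι + 1) * r := le_mul_of_one_le_left' (by simp)
      _ ≤ 1 := hr.le.trans (by simp)
  let E : List (Option ι) → Set Ω := fun w =>
    {ω | Admissible step (badSet ω) (o, 0) w ∧ (upSites step (o, 0) w).Nodup}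
  have hcover : {ω | Reached step (badSet ω) (o, 0)} ⊆
      ⋃ m : ℕ, ⋃ w : List.Vector (Option ι) (m + 1), E w.toList := by
    rintro ω ⟨w, hw⟩
    obtain ⟨_ | ⟨s, w⟩, hw, hnodup⟩ := hw.exists_nodup_upSites
    · exact absurd hw (lt_irrefl 0)
    · exact Set.mem_iUnion₂.2 ⟨w.length, ⟨s :: w, rfl⟩, hw, hnodup⟩
  calc μ {ω | Reached step (badSet ω) (o, 0)}
      ≤ ∑' m : ℕ, ∑' w : List.Vector (Option ι) (m + 1), μ (E w.toList) :=
        (measure_mono hcover).trans <| (measure_iUnion_le _).trans <|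
          ENNReal.tsum_le_tsum fun m => measure_iUnion_le _
    _ ≤ ∑' m : ℕ, ∑' _ : List.Vector (Option ι) (m + 1), r ^ (m + 1) :=
        ENNReal.tsum_le_tsum fun m => ENNReal.tsum_le_tsum fun w =>
          (measure_admissible_nodup_le hr1 hbad le_rfl _).trans_eq (by rw [w.toList_length])
    _ = ∑' m : ℕ, ((Fintype.card ι + 1) * r) ^ (m + 1) := by
        simp only [tsum_fintype, Finset.sum_const, Finset.card_univ, card_vector,
          Fintype.card_option, nsmul_eq_mul, mul_pow, Nat.cast_pow, Nat.cast_add, Nat.cast_one]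
    _ < 1 := tsum_pow_add_one_lt_one hr

theorem measure_exists_height_pos [IsProbabilityMeasure μ]
    (hstep : ∀ v, Relation.ReflTransGen (fun u v => ∃ i, step i u = v) o v)
    (hr : (Fintype.card ι + 1) * r < 2⁻¹)
    (hbad : ∀ S : Finset (V × ℤ), μ {ω | ↑S ⊆ badSet ω} ≤ r ^ (2 * S.card)) :
    0 < μ {ω | ∃ F : V → ℤ, F o = 0 ∧ (∀ i v, F (step i v) ≤ F v + 1) ∧
      ∀ v, (v, F v) ∉ badSet ω} := by
  set G := {ω | ∃ F : V → ℤ, F o = 0 ∧ (∀ i v, F (step i v) ≤ F v + 1) ∧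
    ∀ v, (v, F v) ∉ badSet ω}
  have hcover : Set.univ ⊆ {ω | Reached step (badSet ω) (o, 0)} ∪ G := fun ω _ =>
    or_iff_not_imp_left.2 (exists_height_of_not_reached hstep)
  have hlt : μ {ω | Reached step (badSet ω) (o, 0)} < 1 := measure_reached_lt_one hr hbad
  refine pos_iff_ne_zero.2 fun hG => hlt.not_ge ?_
  calc 1 = μ Set.univ := measure_univ.symm
    _ ≤ μ {ω | Reached step (badSet ω) (o, 0)} + μ G :=
      (measure_mono hcover).trans (measure_union_le _ _)
    _ = μ {ω | Reached step (badSet ω) (o, 0)} := by rw [hG, add_zero]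

theorem int_reflTransGen_add_units (x : ℤ) :
    Relation.ReflTransGen (fun x y : ℤ => ∃ s : ℤˣ, x + s = y) 0 x := by
  induction x using Int.induction_on with
  | zero => exact .refl
  | succ x ih => exact ih.tail ⟨1, by simp⟩
  | pred x ih => exact ih.tail ⟨-1, by simp [sub_eq_add_neg]⟩

theorem measure_exists_lipschitz_pos {badSet : Ω → Set (ℤ × ℤ)} [IsProbabilityMeasure μ]
    (hr : 3 * r < 2⁻¹)
    (hbad : ∀ S : Finset (ℤ × ℤ), μ {ω | ↑S ⊆ badSet ω} ≤ r ^ (2 * S.card)) :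
    0 < μ {ω | ∃ F : ℤ → ℤ, F 0 = 0 ∧ (∀ x, |F (x + 1) - F x| ≤ 1) ∧
      ∀ x, (x, F x) ∉ badSet ω} := by
  have hcard : ((Fintype.card ℤˣ : ENNReal) + 1) * r < 2⁻¹ := by
    rw [Fintype.card_units_int]
    norm_num [hr]
  refine (measure_exists_height_pos (step := fun (s : ℤˣ) (x : ℤ) => x + s) (o := 0)
    int_reflTransGen_add_units hcard hbad).trans_le (measure_mono ?_)
  rintro ω ⟨F, hF0, hF, hgood⟩
  refine ⟨F, hF0, fun x => abs_le.2 ⟨?_, ?_⟩, hgood⟩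
  · have := hF (-1) (x + 1)
    simp only [Units.val_neg, Units.val_one, add_neg_cancel_right] at this
    omega
  · have := hF 1 x
    simp only [Units.val_one] at this
    omega

end Lipschitz

section OpenPaths

variable {n : ℕ} {ω : Config n} {x y z : Site n}

theorem connects_iff_exists_walk :
    Connects ω x y ↔ ∃ w : (lattice n).Walk x y, ∀ z ∈ w.support, ω z = true := by
  classical
  refine ⟨fun ⟨w, _, h⟩ => ⟨w, h⟩, fun ⟨w, h⟩ => ⟨w.bypass, w.bypass_isPath, fun z hz => ?_⟩⟩
  exact h z (w.support_bypass_subset_support hz)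

theorem Connects.refl (h : ω x = true) : Connects ω x x :=
  connects_iff_exists_walk.2 ⟨.nil, by simpa using h⟩

theorem Connects.symm (h : Connects ω x y) : Connects ω y x := by
  obtain ⟨w, hw⟩ := connects_iff_exists_walk.1 h
  exact connects_iff_exists_walk.2 ⟨w.reverse, by simpa using hw⟩

theorem Connects.trans (hxy : Connects ω x y) (hyz : Connects ω y z) : Connects ω x z := by
  obtain ⟨w, hw⟩ := connects_iff_exists_walk.1 hxy
  obtain ⟨w', hw'⟩ := connects_iff_exists_walk.1 hyz
  refine connects_iff_exists_walk.2 ⟨w.append w', fun z hz => ?_⟩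
  exact ((SimpleGraph.Walk.mem_support_append_iff w w').1 hz).elim (hw z) (hw' z)

theorem connects_of_adj (h : (lattice n).Adj x y) (hx : ω x = true) (hy : ω y = true) :
    Connects ω x y :=
  connects_iff_exists_walk.2 ⟨h.toWalk, by simp [hx, hy]⟩

theorem lattice_adj_of_covBy (h : x ⋖ y) : (lattice n).Adj x y := by
  obtain ⟨i, hi, hne⟩ := Pi.covBy_iff.1 h
  change ∑ j, |x j - y j| = 1
  rw [Finset.sum_eq_single i (fun j _ hj => by simp [hne j hj]) (by simp),
    ← Order.covBy_iff_add_one_eq.1 hi]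
  simp

theorem connects_of_Icc_open (hxy : x ≤ y) (h : ∀ z ∈ Set.Icc x y, ω z = true) :
    Connects ω x y := by
  induction le_iff_reflTransGen_covBy.1 hxy with
  | refl => exact .refl (h x ⟨le_rfl, le_rfl⟩)
  | @tail u v hxu huv ih =>
    have hxu := le_iff_reflTransGen_covBy.2 hxu
    have hux := ih hxu fun z hz => h z ⟨hz.1, hz.2.trans huv.le⟩
    exact hux.trans <|
      connects_of_adj (lattice_adj_of_covBy huv) (h u ⟨hxu, huv.le⟩) (h v ⟨hxy, le_rfl⟩)

theorem connects_of_uIcc_open (h : ∀ z ∈ Set.uIcc x y, ω z = true) : Connects ω x y := by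
  have hx : Connects ω x (x ⊔ y) :=
    connects_of_Icc_open le_sup_left fun z hz => h z ⟨inf_le_left.trans hz.1, hz.2⟩
  have hy : Connects ω y (x ⊔ y) :=
    connects_of_Icc_open le_sup_right fun z hz => h z ⟨inf_le_right.trans hz.1, hz.2⟩
  exact hx.trans hy.symm

end OpenPaths

section Plane

variable {n : ℕ}

/-- A linear embedding of `ℤ²` into `ℤⁿ`, chosen so that any two coordinates of the image of a point
determine that point. -/
def planeEmb (n : ℕ) (z : ℤ × ℤ) : Site n := fun i => z.1 + (i : ℕ) * z.2

/-- The `ℓ^∞`-ball of radius `n` around the origin of `ℤⁿ`. The radius is the largest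
`ℓ^∞`-distance between the images under `planeEmb n` of consecutive points on the graph of a
Lipschitz function. -/
noncomputable def box (n : ℕ) : Finset (Site n) := Fintype.piFinset fun _ => Finset.Icc (-n : ℤ) n

/-- The points of `ℤ²` such that the box around their image under `planeEmb n` contains a closed
site. -/
def badPoints (ω : Config n) : Set (ℤ × ℤ) := {z | ∃ b ∈ box n, ω (planeEmb n z + b) = false}

theorem mem_box {b : Site n} : b ∈ box n ↔ ∀ i, |b i| ≤ n := by
  simp [box, abs_le]

theorem planeEmb_zero : planeEmb n 0 = 0 := by
  ext
  simp [planeEmb]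

theorem open_of_notMem_badPoints {ω : Config n} {z : ℤ × ℤ} (hz : z ∉ badPoints ω) {v : Site n}
    (hv : ∀ i, |v i - planeEmb n z i| ≤ n) : ω v = true := by
  by_contra h
  exact hz ⟨v - planeEmb n z, mem_box.2 hv, by simpa using h⟩

theorem abs_planeEmb_sub_le {x a b : ℤ} (hab : |b - a| ≤ 1) (i : Fin n) :
    |planeEmb n (x + 1, b) i - planeEmb n (x, a) i| ≤ n := by
  calc |planeEmb n (x + 1, b) i - planeEmb n (x, a) i|
      = |1 + (i : ℕ) * (b - a)| := by
        congr 1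
        simp only [planeEmb]
        ring
    _ ≤ |1| + |((i : ℕ) : ℤ) * (b - a)| := abs_add_le _ _
    _ = 1 + (i : ℕ) * |b - a| := by simp [abs_mul]
    _ ≤ 1 + (i : ℕ) * 1 := by gcongr
    _ ≤ n := by omega

theorem planeEmb_injective_of_ne {i j : Fin n} (hij : i ≠ j) :
    Function.Injective fun z => (planeEmb n z i, planeEmb n z j) := by
  intro z z' h
  obtain ⟨hi, hj⟩ := Prod.ext_iff.1 h
  simp only [planeEmb] at hi hj
  have hne : ((i : ℕ) : ℤ) - (j : ℕ) ≠ 0 := by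
    rw [sub_ne_zero]
    exact_mod_cast Fin.val_ne_of_ne hij
  have hsnd : z.2 = z'.2 := mul_left_cancel₀ hne (by linear_combination hi - hj)
  exact Prod.ext (by rw [hsnd] at hi; exact add_right_cancel hi) hsnd

theorem infinite_cluster_of_lipschitz (hn : 0 < n) {ω : Config n} {F : ℤ → ℤ} (hF0 : F 0 = 0)
    (hF : ∀ x, |F (x + 1) - F x| ≤ 1) (hgood : ∀ x, (x, F x) ∉ badPoints ω) :
    (cluster ω 0).Infinite := by
  have hopen : ∀ x, ∀ v : Site n, (∀ i, |v i - planeEmb n (x, F x) i| ≤ n) → ω v = true :=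
    fun x _ => open_of_notMem_badPoints (hgood x)
  have hstart : planeEmb n (0, F 0) = 0 := by rw [hF0]; exact planeEmb_zero
  have hconn : ∀ m : ℕ, Connects ω 0 (planeEmb n (m, F m)) := by
    intro m
    induction m with
    | zero =>
      rw [Nat.cast_zero, hstart]
      exact .refl (hopen 0 0 fun i => by simp [hstart])
    | succ m ih =>
      refine ih.trans (connects_of_uIcc_open fun v hv => hopen m v fun i => ?_)
      rw [← Set.pi_univ_uIcc, Nat.cast_succ] at hv
      exact (Set.abs_sub_left_of_mem_uIcc (hv i trivial)).trans (abs_planeEmb_sub_le (hF m) i)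
  refine Set.infinite_of_injective_forall_mem (fun m m' h => ?_) hconn
  simpa [planeEmb] using congrFun h ⟨0, hn⟩

end Plane

section Domination

theorem measure_forall_exists_mem_le {Ω W Z : Type*} [MeasurableSpace Ω] {μ : Measure Ω}
    {closed : Ω → Set W} {N : Z → Finset W} {K M : ℕ} {ε : ENNReal} (hε : ε ≤ 1)
    (hclosed : ∀ T : Finset W, μ {ω | ↑T ⊆ closed ω} ≤ (ε ^ K) ^ T.card)
    (hM : ∀ z, (N z).card ≤ M) (hK : ∀ v (S : Finset Z), (∀ z ∈ S, v ∈ N z) → S.card ≤ K)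
    (S : Finset Z) :
    μ {ω | ∀ z ∈ S, ∃ v ∈ N z, v ∈ closed ω} ≤ (M * ε) ^ S.card := by
  classical
  let choices : Finset (S → W) := Fintype.piFinset fun z => N z
  have hchoice : ∀ c ∈ choices, μ {ω | ∀ z, c z ∈ closed ω} ≤ ε ^ S.card := by
    intro c hc
    have hfiber : ∀ v ∈ Finset.univ.image c, (Finset.univ.filter (c · = v)).card ≤ K := by
      intro v _
      rw [← Finset.card_map (Function.Embedding.subtype (· ∈ S))]
      refine hK v _ fun _ hz => ?_
      obtain ⟨z, hzv, rfl⟩ := Finset.mem_map.1 hz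
      obtain ⟨_, rfl⟩ := Finset.mem_filter.1 hzv
      exact Fintype.mem_piFinset.1 hc z
    have hcard : S.card ≤ K * (Finset.univ.image c).card := by
      simpa using Finset.card_le_mul_card_image Finset.univ K hfiber
    calc μ {ω | ∀ z, c z ∈ closed ω}
        = μ {ω | ↑(Finset.univ.image c) ⊆ closed ω} := by simp [Set.range_subset_iff]
      _ ≤ ε ^ (K * (Finset.univ.image c).card) := (hclosed _).trans_eq (pow_mul _ _ _).symm
      _ ≤ ε ^ S.card := pow_le_pow_right_of_le_one' hε hcard
  have hcover : {ω | ∀ z ∈ S, ∃ v ∈ N z, v ∈ closed ω} ⊆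
      ⋃ c ∈ choices, {ω | ∀ z, c z ∈ closed ω} := by
    intro ω hω
    choose c hcN hc using fun z : S => hω z z.2
    exact Set.mem_iUnion₂.2 ⟨c, Fintype.mem_piFinset.2 hcN, hc⟩
  calc μ {ω | ∀ z ∈ S, ∃ v ∈ N z, v ∈ closed ω}
      ≤ ∑ c ∈ choices, μ {ω | ∀ z, c z ∈ closed ω} :=
        (measure_mono hcover).trans (measure_biUnion_finset_le _ _)
    _ ≤ choices.card * ε ^ S.card := by
        simpa using Finset.sum_le_card_nsmul choices _ _ hchoice
    _ ≤ (M ^ S.card : ℕ) * ε ^ S.card := by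
        gcongr
        rw [Fintype.card_piFinset]
        simpa using Finset.prod_le_pow_card Finset.univ (fun z : S => (N z).card) M fun z _ => hM z
    _ = (M * ε) ^ S.card := by rw [Nat.cast_pow, mul_pow]

end Domination

section Law

variable {n k : ℕ} {p : Index n k → unitInterval}

/-- The joint law of the independent families `ω_I`; `hyperplaneLaw p` is its image under
`hyperplaneConfig`. -/
noncomputable def planeConfigLaw (p : Index n k → unitInterval) : Measure (PlaneConfig n k) :=
  Measure.pi fun I => bernoulliSite (CoordPlane I) (p I)

instance : IsProbabilityMeasure (planeConfigLaw p) := by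
  unfold planeConfigLaw
  infer_instance

theorem hyperplaneLaw_eq_map : hyperplaneLaw p = (planeConfigLaw p).map hyperplaneConfig := rfl

theorem planeConfigLaw_forall_mem (b : Bool) (T : Finset (Σ I : Index n k, CoordPlane I)) :
    planeConfigLaw p {ξ | ∀ v ∈ T, ξ v.1 v.2 = b} =
      ∏ v ∈ T, bernoulliMeasure true false (p v.1) {b} := by
  let slice (I : Index n k) : Finset (CoordPlane I) :=
    T.preimage (Sigma.mk I) sigma_mk_injective.injOn
  have hT : T = Finset.univ.sigma slice := by
    ext ⟨I, u⟩
    simp [slice]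
  have hset : {ξ : PlaneConfig n k | ∀ v ∈ T, ξ v.1 v.2 = b} =
      Set.univ.pi fun I => Set.pi (slice I) fun _ => {b} := by
    ext ξ
    simp [slice, Set.mem_pi, Sigma.forall]
  rw [hset, planeConfigLaw, Measure.pi_pi, hT, Finset.prod_sigma]
  exact Finset.prod_congr rfl fun I _ =>
    Measure.infinitePi_pi _ fun _ _ => measurableSet_singleton _

theorem measurableSet_open (v : Site n) : MeasurableSet {ω : Config n | ω v = true} :=
  measurableSet_eq_fun (measurable_pi_apply v) measurable_const

theorem hyperplaneLaw_apply_eq_true (v : Site n) :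
    hyperplaneLaw p {ω | ω v = true} = ∏ I, bernoulliMeasure true false (p I) {true} := by
  let T : Finset (Σ I : Index n k, CoordPlane I) :=
    Finset.univ.sigma fun I => {proj I v}
  have hset : hyperplaneConfig ⁻¹' {ω | ω v = true} =
      {ξ : PlaneConfig n k | ∀ u ∈ T, ξ u.1 u.2 = true} := by
    ext ξ
    simp [hyperplaneConfig, T, Sigma.forall]
  rw [hyperplaneLaw_eq_map, Measure.map_apply measurable_hyperplaneConfig (measurableSet_open v),
    hset, planeConfigLaw_forall_mem, Finset.prod_sigma]
  simp only [Finset.prod_singleton]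

theorem integral_toNat_apply (v : Site n) :
    ∫ ω, ((ω v).toNat : ℝ) ∂(hyperplaneLaw p) = ∏ I, (p I : ℝ) := by
  have hind : (fun ω : Config n => ((ω v).toNat : ℝ)) = Set.indicator {ω | ω v = true} 1 := by
    ext ω
    by_cases h : ω v = true <;> simp [h]
  rw [hind, integral_indicator_one (measurableSet_open v), measureReal_def,
    hyperplaneLaw_apply_eq_true, ENNReal.toReal_prod]
  refine Finset.prod_congr rfl fun I _ => ?_
  simp [bernoulliMeasure_apply _ (measurableSet_singleton true)]

/-- The sites of the coordinate hyperplanes on which the states in the box around the image of `z`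
depend. -/
noncomputable def footprint (n k : ℕ) (z : ℤ × ℤ) : Finset (Σ I : Index n k, CoordPlane I) :=
  (Finset.univ ×ˢ box n).image fun c => ⟨c.1, proj c.1 (planeEmb n z + c.2)⟩

theorem card_footprint_le (z : ℤ × ℤ) :
    (footprint n k z).card ≤ Fintype.card (Index n k) * (box n).card :=
  Finset.card_image_le.trans_eq (by rw [Finset.card_product, Finset.card_univ])

theorem mem_badPoints_hyperplaneConfig {ξ : PlaneConfig n k} {z : ℤ × ℤ} :
    z ∈ badPoints (hyperplaneConfig ξ) ↔ ∃ v ∈ footprint n k z, ξ v.1 v.2 = false := by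
  simp only [badPoints, hyperplaneConfig, Set.mem_ofPred_eq, decide_eq_false_iff_not, not_forall,
    Bool.not_eq_true, footprint, Finset.mem_image, Finset.mem_product, Finset.mem_univ, true_and]
  constructor
  · rintro ⟨b, hb, I, hI⟩
    exact ⟨_, ⟨(I, b), hb, rfl⟩, hI⟩
  · rintro ⟨_, ⟨c, hb, rfl⟩, hI⟩
    exact ⟨c.2, hb, c.1, hI⟩

theorem abs_sub_planeEmb_le_of_mem_footprint {z : ℤ × ℤ} {I : Index n k} {u : CoordPlane I}
    (h : ⟨I, u⟩ ∈ footprint n k z) {i : Fin n} (hi : i ∈ I.1) :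
    |u.1 i - planeEmb n z i| ≤ n := by
  obtain ⟨⟨J, b⟩, hb, hJ⟩ := Finset.mem_image.1 h
  obtain ⟨rfl, hu⟩ := Sigma.mk.inj hJ
  obtain rfl := eq_of_heq hu
  simpa [proj, hi] using mem_box.1 (Finset.mem_product.1 hb).2 i

theorem card_le_of_forall_mem_footprint (hk : 2 ≤ k) (v : Σ I : Index n k, CoordPlane I)
    (S : Finset (ℤ × ℤ)) (hS : ∀ z ∈ S, v ∈ footprint n k z) : S.card ≤ (2 * n + 1) ^ 2 := by
  obtain ⟨I, u⟩ := v
  obtain ⟨i, hi, j, hj, hij⟩ := Finset.one_lt_card.1 (show 1 < I.1.card by rw [I.2]; omega)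
  let window (l : Fin n) : Finset ℤ := Finset.Icc (u.1 l - n) (u.1 l + n)
  have hwindow : ∀ l, (window l).card = 2 * n + 1 := fun l => by
    simp only [window, Int.card_Icc]
    omega
  have hmem : ∀ z ∈ S, ∀ l ∈ I.1, planeEmb n z l ∈ window l := fun z hz l hl => by
    have := abs_le.1 (abs_sub_planeEmb_le_of_mem_footprint (hS z hz) hl)
    exact Finset.mem_Icc.2 ⟨by omega, by omega⟩
  calc S.card ≤ (window i ×ˢ window j).card :=
        Finset.card_le_card_of_injOn _
          (fun z hz => Finset.mem_product.2 ⟨hmem z hz i hi, hmem z hz j hj⟩)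
          (planeEmb_injective_of_ne hij).injOn
    _ = (2 * n + 1) ^ 2 := by rw [Finset.card_product, hwindow, hwindow, sq]

theorem planeConfigLaw_subset_badPoints_le (hk : 2 ≤ k) {ε : ENNReal} (hε : ε ≤ 1)
    (hp : ∀ I, bernoulliMeasure true false (p I) {false} ≤ ε ^ (2 * n + 1) ^ 2)
    (S : Finset (ℤ × ℤ)) :
    planeConfigLaw p {ξ | ↑S ⊆ badPoints (hyperplaneConfig ξ)} ≤
      ((Fintype.card (Index n k) * (box n).card : ℕ) * ε) ^ S.card := by
  have hclosed : ∀ T : Finset (Σ I : Index n k, CoordPlane I),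
      planeConfigLaw p {ξ | ↑T ⊆ {v : Σ I, CoordPlane I | ξ v.1 v.2 = false}} ≤
        (ε ^ (2 * n + 1) ^ 2) ^ T.card := fun T =>
    (planeConfigLaw_forall_mem false T).trans_le <|
      Finset.prod_le_pow_card T _ _ fun v _ => hp v.1
  have hset : {ξ : PlaneConfig n k | ↑S ⊆ badPoints (hyperplaneConfig ξ)} =
      {ξ | ∀ z ∈ S, ∃ v ∈ footprint n k z, ξ v.1 v.2 = false} := by
    ext ξ
    exact forall₂_congr fun z _ => mem_badPoints_hyperplaneConfig
  rw [hset]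
  exact measure_forall_exists_mem_le hε hclosed card_footprint_le
    (card_le_of_forall_mem_footprint hk) S

theorem hyperplaneLaw_originPercolates_pos (hk : 2 ≤ k) (hn : 0 < n) {ε : ENNReal}
    (hε : (Fintype.card (Index n k) * (box n).card : ℕ) * ε ≤ 8⁻¹ ^ 2) (hε1 : ε ≤ 1)
    (hp : ∀ I, bernoulliMeasure true false (p I) {false} ≤ ε ^ (2 * n + 1) ^ 2) :
    0 < hyperplaneLaw p (originPercolates n) := by
  have hbad : ∀ S : Finset (ℤ × ℤ),
      planeConfigLaw p {ξ | ↑S ⊆ badPoints (hyperplaneConfig ξ)} ≤ 8⁻¹ ^ (2 * S.card) := fun S =>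
    (planeConfigLaw_subset_badPoints_le hk hε1 hp S).trans <| by
      rw [pow_mul]
      exact pow_le_pow_left' hε _
  have hr : (3 : ENNReal) * 8⁻¹ < 2⁻¹ := by
    rw [← ENNReal.toReal_lt_toReal (by finiteness) (by simp)]
    norm_num
  calc 0 < planeConfigLaw p {ξ | ∃ F : ℤ → ℤ, F 0 = 0 ∧ (∀ x, |F (x + 1) - F x| ≤ 1) ∧
        ∀ x, (x, F x) ∉ badPoints (hyperplaneConfig ξ)} := measure_exists_lipschitz_pos hr hbad
    _ ≤ planeConfigLaw p (hyperplaneConfig ⁻¹' originPercolates n) :=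
      measure_mono fun ξ ⟨_, hF0, hF, hgood⟩ => infinite_cluster_of_lipschitz hn hF0 hF hgood
    _ ≤ hyperplaneLaw p (originPercolates n) :=
      Measure.le_map_apply measurable_hyperplaneConfig.aemeasurable _

theorem bernoulliMeasure_singleton_false (q : unitInterval) :
    bernoulliMeasure true false q {false} = ENNReal.ofReal (1 - q) := by
  rw [bernoulliMeasure_apply _ (measurableSet_singleton false), if_neg (by simp),
    if_pos (Set.mem_singleton false)]
  exact (ENNReal.ofReal_eq_coe_nnreal _).symm

theorem exists_threshold_originPercolates (hk : 2 ≤ k) (hn : 0 < n) :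
    ∃ δ : ℝ, 0 < δ ∧ ∀ p : Index n k → unitInterval, (∀ I, 1 - δ < p I) →
      0 < hyperplaneLaw p (originPercolates n) := by
  let M : ℕ := Fintype.card (Index n k) * (box n).card
  obtain ⟨ε, hε0, hε⟩ : ∃ ε : NNReal, 0 < ε ∧ (ε : ENNReal) * (M + 1) < 8⁻¹ ^ 2 :=
    ENNReal.exists_nnreal_pos_mul_lt (by finiteness) (by simp)
  have hMε : M * (ε : ENNReal) ≤ 8⁻¹ ^ 2 :=
    calc M * (ε : ENNReal) ≤ ε * (M + 1) := by rw [mul_comm]; gcongr; exact le_self_add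
      _ ≤ 8⁻¹ ^ 2 := hε.le
  have hε1 : (ε : ENNReal) ≤ 1 :=
    calc (ε : ENNReal) ≤ ε * (M + 1) := le_mul_of_one_le_right' le_add_self
      _ ≤ 1 := hε.le.trans (pow_le_one' (by simp) 2)
  refine ⟨ε ^ (2 * n + 1) ^ 2, by positivity, fun p hp =>
    hyperplaneLaw_originPercolates_pos hk hn hMε hε1 fun I => ?_⟩
  rw [bernoulliMeasure_singleton_false]
  refine ENNReal.ofReal_le_of_le_toReal ?_
  rw [ENNReal.toReal_pow, ENNReal.coe_toReal]
  linarith [hp I]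

end Law

end HyperplanePercolation

theorem mainTheorem4_general (n k : ℕ) (hk : 2 ≤ k) (hn : 0 < n) :
    (∀ p : HyperplanePercolation.Index n k → unitInterval,
      ∫ ω, ((ω 0).toNat : ℝ) ∂(HyperplanePercolation.hyperplaneLaw p) = ∏ I, (p I : ℝ)) ∧
    ∃ δ : ℝ, 0 < δ ∧ ∀ p : HyperplanePercolation.Index n k → unitInterval,
      1 - δ < ∫ ω, ((ω 0).toNat : ℝ) ∂(HyperplanePercolation.hyperplaneLaw p) →
        0 < HyperplanePercolation.hyperplaneLaw p (HyperplanePercolation.originPercolates n) := by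
  have hdensity (p : HyperplanePercolation.Index n k → unitInterval) :
      ∫ ω, ((ω 0).toNat : ℝ) ∂(HyperplanePercolation.hyperplaneLaw p) = ∏ I, (p I : ℝ) :=
    HyperplanePercolation.integral_toNat_apply 0
  obtain ⟨δ, hδ, hperc⟩ :=
    HyperplanePercolation.exists_threshold_originPercolates (n := n) hk hn
  refine ⟨hdensity, δ, hδ, fun p hp => hperc p fun I => ?_⟩
  calc 1 - δ < ∏ J, (p J : ℝ) := hdensity p ▸ hp
    _ = p I * ∏ J ∈ Finset.univ.erase I, (p J : ℝ) :=
      (Finset.mul_prod_erase _ _ (Finset.mem_univ I)).symm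
    _ ≤ p I := mul_le_of_le_one_right (p I).2.1 <|
      Finset.prod_le_one (fun J _ => (p J).2.1) fun J _ => (p J).2.2

theorem mainTheorem4 (n k : ℕ) (hk : 2 ≤ k) (hkn : k + 2 ≤ n) :
    (∀ p : HyperplanePercolation.Index n k → unitInterval,
      ∫ ω, ((ω 0).toNat : ℝ) ∂(HyperplanePercolation.hyperplaneLaw p) = ∏ I, (p I : ℝ)) ∧
    ∃ δ : ℝ, 0 < δ ∧ ∀ p : HyperplanePercolation.Index n k → unitInterval,
      1 - δ < ∫ ω, ((ω 0).toNat : ℝ) ∂(HyperplanePercolation.hyperplaneLaw p) →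
        0 < HyperplanePercolation.hyperplaneLaw p (HyperplanePercolation.originPercolates n) :=
  mainTheorem4_general n k hk (by omega)
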